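/- Let $\mathcal S$ be a system of timed communicating automata (TCA): a directed graph (topology) with a set $P$ of processes as nodes and channels $C\subseteq P\times P$ as edges, a finite set of messages, a set $X^{c}$ of channel clocks for each $c\in C$, and for each process $p$ a set $X^p$ of local clocks, a finite set of control locations with an initial location $\ell^p_I$ and a final location $\ell^p_F$, and a set of transitions $\ell\xrightarrow{op}r$ where $op$ is one of $\mathsf{nop}$, $\mathsf{elapse}$, $\mathsf{test}(\varphi)$, $\mathsf{reset}(x)$ with $x\in X^p$, $\mathsf{send}(m,pq,\psi)$ or $\mathsf{receive}(m,qp,\psi)$. Clocks are classical, integral or fractional; in a constraint a clock with value $a\in\mathbb Q_{\ge0}$ is evaluated as $a$, $\lfloor a\rfloor$, $a-\lfloor a\rfloor$, respectively. The constraints $\varphi$ (over $X^p$) and $\psi$ (over $X^p$ and the clocks of the channel) are Boolean combinations of $x\sim k$, $x-x'\sim k$, $\lfloor x\rfloor\equiv k \pmod m$, $\lfloor x-x'\rfloor\equiv k\pmod m$ (for $x,x'$ both classical or both integral), and $y=0$, $y\sim y'$ (for $y,y'$ fractional), where $\sim\,\in\{\le,<,\ge,>\}$, $k\in\mathbb Z$,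 $m\ge1$. Assume that every process $p$ has a special local clock $x_0^p$ that is never reset and appears in no constraint. A configuration $\langle \ell,\mu,u\rangle$ consists of a location $\ell^p$ for every process, a valuation $\mu$ of the local clocks in $\mathbb Q_{\ge 0}$, and for every channel $c$ a finite sequence $u^c$ of pairs $(m,\nu)$ of a message and a valuation $\nu\in\mathbb Q_{\ge0}^{X^c}$. *Desynchronised semantics.* Configurations are those with $\mu(x_0^p)\le\mu(x_0^q)$ for every channel $pq$. Initially all processes are in their initial locations, all local clocks are $0$ and all channels are empty. In a final configuration, all processes are in their final locations, all channels are empty, and all local clocks other than the special ones are $0$. For a duration $\delta\in\mathbb Q_{\ge 0}$ there is a time elapse step in which some single process $q$ takes an $\mathsf{elapse}$ transition, $\delta$ is added to all clocks in $X^q$ and to all clocks of all messages in channels $pq$ towards $q$, and nothing else changes. Otherwise one process takes one transition: $\mathsf{nop}$ changes no clock and no channel, $\mathsf{test}(\varphi)$ additionally requires $\mu\models\varphi$, and $\mathsf{reset}(x)$ sets $x$ to $0$; $\mathsf{send}(m,pq,\psi)$, executed by $p$, leaves $\mu$ unchanged, chooses $\nu\in\mathbb Q_{\ge0}^{X^{pq}}$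 with $(\mu,\nu)\models\psi$ and inserts $(m,\nu+\delta)$ at the tail of the FIFO channel $pq$, where $\delta=\mu(x_0^q)-\mu(x_0^p)\geq 0$; $\mathsf{receive}(m,pq,\psi)$, executed by $q$, leaves $\mu$ unchanged and removes an item $(m,\nu)$ with $(\mu,\nu)\models\psi$ from the head of the channel $pq$. *Rendezvous semantics.* This is the restriction of the desynchronised semantics to configurations in which all channels are empty, where the send and receive steps are replaced by the following atomic step: for a channel $pq$, $p$ takes a transition $\mathsf{send}(m,pq,\psi)$ and at the same time $q$ takes a transition $\mathsf{receive}(m,pq,\psi')$, provided that there is $\nu\in\mathbb Q_{\ge0}^{X^{pq}}$ with $(\mu,\nu)\models\psi$ and $(\mu,\nu+\delta)\models\psi'$, where $\delta=\mu(x_0^q)-\mu(x_0^p)\ge0$; clocks and the locations of other processes do not change. **Lemma.** Suppose that the topology is a polyforest, i.e. it has no self-loops and no pair of opposite edges, and its underlying undirected graph is a forest. Then the desynchronised semantics is equivalent to the rendezvous semantics with respect to non-emptiness: a final configuration is reachable from the initial configuration in the desynchronised semantics if and only if a final configuration is reachable from it in the rendezvous semantics. Moreover this equivalence holds for each final configuration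 separately (that is, for each choice of the final values of the special clocks). -/

import Mathlib

/-! ## Labelled transition systems -/

/-- A labelled transition system with configurations `C` and actions `A`. -/
structure LTS (C : Type*) (A : Type*) where
  init : C
  final : C
  step : C → A → C → Prop

namespace LTS

/-- `L.Run c w d`: the sequence of actions `w` leads from `c` to `d`. -/
def Run {C : Type*} {A : Type*} (L : LTS C A) : C → List A → C → Prop
  | c, [], d => c = d
  | c, a :: w, d => ∃ e, L.step c a e ∧ L.Run e w d

/-- The non-emptiness problem for `L` has a positive answer. -/
def NonEmpty {C : Type*} {A : Type*} (L : LTS C A) : Prop :=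
  ∃ w : List A, L.Run L.init w L.final

/-- Equivalence: the non-emptiness problem has the same answer. -/
def Equivalent {C A C' A' : Type*} (L : LTS C A) (L' : LTS C' A') : Prop :=
  L.NonEmpty ↔ L'.NonEmpty

end LTS

/-! ## Clock constraints -/

/-- The three types of clocks. -/
inductive ClockKind
  | classical
  | integral
  | fractional

/-- The comparison symbols `≤`, `<`, `≥`, `>`. -/
inductive Cmp
  | le
  | lt
  | ge
  | gt

/-- The meaning of a comparison symbol. -/
def Cmp.Holds : Cmp → ℚ → ℚ → Prop
  | .le, a, b => a ≤ b
  | .lt, a, b => a < b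
  | .ge, a, b => b ≤ a
  | .gt, a, b => b < a

/-- Clock constraints over the clocks `X` of types `κ`: boolean combinations of atomic constraints.
Inequality and modular constraints speak about classical and integral clocks (in the diagonal
case two clocks of the same type), order constraints about fractional clocks. -/
inductive ClockConstraint {X : Type*} (κ : X → ClockKind)
  | tt
  | ineq (x : X) (hx : κ x ≠ .fractional) (r : Cmp) (k : ℤ)
  | modular (x : X) (hx : κ x ≠ .fractional) (m : ℕ+) (k : ℤ)
  | isZero (y : X) (hy : κ y = .fractional)
  | diagIneq (x₀ x₁ : X) (hx : κ x₀ ≠ .fractional) (hxx : κ x₀ = κ x₁) (r : Cmp) (k : ℤ)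
  | diagModular (x₀ x₁ : X) (hx : κ x₀ ≠ .fractional) (hxx : κ x₀ = κ x₁) (m : ℕ+) (k : ℤ)
  | order (y₀ y₁ : X) (hy₀ : κ y₀ = .fractional) (hy₁ : κ y₁ = .fractional) (r : Cmp)
  | neg (φ : ClockConstraint κ)
  | conj (φ ψ : ClockConstraint κ)
  | disj (φ ψ : ClockConstraint κ)

/-- The value at which a clock of the given type is evaluated in a constraint. -/
def ClockKind.value : ClockKind → NNRat → ℚ
  | .classical, a => (a : ℚ)
  | .integral, a => (⌊(a : ℚ)⌋ : ℚ)
  | .fractional, a => Int.fract (a : ℚ)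

namespace ClockConstraint

/-- `φ.Sat μ`: the valuation `μ` satisfies `φ`. -/
def Sat {X : Type*} {κ : X → ClockKind} (μ : X → NNRat) : ClockConstraint κ → Prop
  | tt => True
  | ineq x _ r k => r.Holds ((κ x).value (μ x)) k
  | modular x _ m k => ⌊(κ x).value (μ x)⌋ ≡ k [ZMOD m]
  | isZero y _ => (κ y).value (μ y) = 0
  | diagIneq x₀ x₁ _ _ r k => r.Holds ((κ x₀).value (μ x₀) - (κ x₁).value (μ x₁)) k
  | diagModular x₀ x₁ _ _ m k =>
      ⌊(κ x₀).value (μ x₀) - (κ x₁).value (μ x₁)⌋ ≡ k [ZMOD m]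
  | order y₀ y₁ _ _ r => r.Holds ((κ y₀).value (μ y₀)) ((κ y₁).value (μ y₁))
  | neg φ => ¬ φ.Sat μ
  | conj φ ψ => φ.Sat μ ∧ ψ.Sat μ
  | disj φ ψ => φ.Sat μ ∨ ψ.Sat μ

/-- The clocks that appear in a constraint. -/
def clocks {X : Type*} {κ : X → ClockKind} : ClockConstraint κ → Set X
  | tt => ∅
  | ineq x _ _ _ => {x}
  | modular x _ _ _ => {x}
  | isZero y _ => {y}
  | diagIneq x₀ x₁ _ _ _ _ => {x₀, x₁}
  | diagModular x₀ x₁ _ _ _ _ => {x₀, x₁}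
  | order y₀ y₁ _ _ _ => {y₀, y₁}
  | neg φ => φ.clocks
  | conj φ ψ => φ.clocks ∪ ψ.clocks
  | disj φ ψ => φ.clocks ∪ ψ.clocks

end ClockConstraint

/-! ## Topologies -/

/-- A polyforest: a directed graph without self-loops and without pairs of opposite edges (so that
every undirected edge carries exactly one orientation), whose underlying undirected graph is a
forest. -/
structure Digraph.IsPolyforest {P : Type*} (T : Digraph P) : Prop where
  asymm : ∀ p q, T.Adj p q → ¬ T.Adj q p
  forest : T.toSimpleGraphInclusive.IsAcyclic

/-- The channels of a communication topology. -/
structure Digraph.Channel {P : Type*} (T : Digraph P) where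
  src : P
  dst : P
  adj : T.Adj src dst

/-! ## Systems of timed communicating automata -/

universe u v

/-- Topology, messages, local clocks and channel clocks (with their types) of a system of timed
communicating automata over the set `P` of processes. -/
structure TCASignature (P : Type u) where
  topology : Digraph P
  Msg : Type v
  finite_msg : Finite Msg
  LClock : P → Type v
  lkind : ∀ p, LClock p → ClockKind
  CClock : topology.Channel → Type v
  ckind : ∀ c, CClock c → ClockKind

namespace TCASignature

variable {P : Type u} (S : TCASignature.{u, v} P)

/-- The types of the clocks in `X^p ∪ X^c`. -/
def jointKind (p : P) (c : S.topology.Channel) : S.LClock p ⊕ S.CClock c → ClockKind :=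
  Sum.elim (S.lkind p) (S.ckind c)

/-- The operations of the process `p`. It sends over its outgoing channels and receives from its
incoming ones. -/
inductive Op (p : P) : Type (max u v)
  | nop
  | elapse
  | test (φ : ClockConstraint (S.lkind p))
  | reset (x : S.LClock p)
  | send (m : S.Msg) (c : S.topology.Channel) (hc : c.src = p)
      (ψ : ClockConstraint (S.jointKind p c))
  | recv (m : S.Msg) (c : S.topology.Channel) (hc : c.dst = p)
      (ψ : ClockConstraint (S.jointKind p c))

/-- Valuations of the local clocks. -/
abbrev LVal : Type (max u v) := ∀ p, S.LClock p → NNRat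

/-- Valuations of the clocks of a channel. -/
abbrev CVal (c : S.topology.Channel) : Type v := S.CClock c → NNRat

/-- Contents of a channel. Messages are inserted on the left and removed on the right. -/
abbrev Content (c : S.topology.Channel) : Type v := List (S.Msg × S.CVal c)

/-- `u + δ` for a channel content `u`. -/
def Content.shift {S : TCASignature.{u, v} P} {c : S.topology.Channel}
    (u : S.Content c) (δ : NNRat) : S.Content c :=
  u.map fun e => (e.1, fun x => e.2 x + δ)

end TCASignature

/-- A system of timed communicating automata over the set `P` of processes. -/
structure TCA (P : Type u) extends TCASignature.{u, v} P where
  Loc : P → Type v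
  finite_loc : ∀ p, Finite (Loc p)
  initLoc : ∀ p, Loc p
  finalLoc : ∀ p, Loc p
  trans : ∀ p, Loc p → toTCASignature.Op p → Loc p → Prop

namespace TCA

variable {P : Type u} (S : TCA.{u, v} P)

/-- The standing assumption on the special clocks `x₀ p`: they are never reset and do not appear
in any constraint. -/
structure IsSpecial (x₀ : ∀ p, S.LClock p) : Prop where
  not_reset : ∀ p ℓ r, ¬ S.trans p ℓ (.reset (x₀ p)) r
  not_test : ∀ p ℓ φ r, S.trans p ℓ (.test φ) r → x₀ p ∉ φ.clocks
  not_send : ∀ p ℓ m c hc ψ r, S.trans p ℓ (.send m c hc ψ) r → Sum.inl (x₀ p) ∉ ψ.clocks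
  not_recv : ∀ p ℓ m c hc ψ r, S.trans p ℓ (.recv m c hc ψ) r → Sum.inl (x₀ p) ∉ ψ.clocks

/-- Configurations: control locations, local clock valuation, channel contents. -/
structure Config where
  loc : ∀ p, S.Loc p
  val : S.LVal
  chan : ∀ c, S.Content c

/-- The initial configuration, as a member of the set of all configurations. -/
def initConfig : S.Config where
  loc := S.initLoc
  val := fun _ _ => 0
  chan := fun _ => []

/-- The configuration with final locations, local clocks `μ` and empty channels. -/
def finalConfig (μ : S.LVal) : S.Config where
  loc := S.finalLoc
  val := μ
  chan := fun _ => []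

/-- Effect on clocks and channels of executing `op` as process `p` in the desynchronised
semantics. `elapse` has no effect here, since time elapses by the durations. -/
def OpEffect (x₀ : ∀ p, S.LClock p) (a : S.Config) (p : P) (b : S.Config) : S.Op p → Prop
  | .nop => b.val = a.val ∧ b.chan = a.chan
  | .elapse => False
  | .test φ => φ.Sat (a.val p) ∧ b.val = a.val ∧ b.chan = a.chan
  | .reset x =>
      (b.val p x = 0 ∧ (∀ y, y ≠ x → b.val p y = a.val p y) ∧ ∀ q, q ≠ p → b.val q = a.val q) ∧
        b.chan = a.chan
  | .send m c _ ψ =>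
      b.val = a.val ∧
      (∃ (ν : S.CVal c) (δ : NNRat),
        ψ.Sat (Sum.elim (a.val p) ν) ∧
        a.val c.dst (x₀ c.dst) = a.val c.src (x₀ c.src) + δ ∧
        b.chan c = (m, fun x => ν x + δ) :: a.chan c) ∧
      ∀ d, d ≠ c → b.chan d = a.chan d
  | .recv m c _ ψ =>
      b.val = a.val ∧
      (∃ ν : S.CVal c,
        a.chan c = b.chan c ++ [(m, ν)] ∧ ψ.Sat (Sum.elim (a.val p) ν)) ∧
      ∀ d, d ≠ c → b.chan d = a.chan d

/-- The process `p` executes `op` in the desynchronised semantics. -/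
def OpStep (x₀ : ∀ p, S.LClock p) (a : S.Config) (p : P) (op : S.Op p) (b : S.Config) : Prop :=
  S.trans p (a.loc p) op (b.loc p) ∧ (∀ q, q ≠ p → b.loc q = a.loc q) ∧ S.OpEffect x₀ a p b op

/-- Local elapse of `δ` time units: it happens in one process `q`, and in the channels
towards `q`. -/
def ElapseStep (a : S.Config) (δ : NNRat) (b : S.Config) : Prop :=
  ∃ q, S.trans q (a.loc q) .elapse (b.loc q) ∧
    (∀ x, b.val q x = a.val q x + δ) ∧
    (∀ c, c.dst = q → b.chan c = (a.chan c).shift δ) ∧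
    (∀ p, p ≠ q → b.loc p = a.loc p ∧ b.val p = a.val p) ∧
    ∀ c, c.dst ≠ q → b.chan c = a.chan c

/-- Rendezvous on a channel `c`: a send and a matching receive, executed atomically. -/
def RendezvousStep (x₀ : ∀ p, S.LClock p) (a : S.Config) (p q : P) (op : S.Op p) (op' : S.Op q)
    (b : S.Config) : Prop :=
  ∃ (m : S.Msg) (c : S.topology.Channel) (hp : c.src = p) (hq : c.dst = q)
    (ψ : ClockConstraint (S.jointKind p c)) (ψ' : ClockConstraint (S.jointKind q c)),
    op = .send m c hp ψ ∧ op' = .recv m c hq ψ' ∧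
    S.trans p (a.loc p) op (b.loc p) ∧ S.trans q (a.loc q) op' (b.loc q) ∧
    (∀ r, r ≠ p → r ≠ q → b.loc r = a.loc r) ∧
    b.val = a.val ∧
    ∃ (ν : S.CVal c) (δ : NNRat),
      a.val q (x₀ q) = a.val p (x₀ p) + δ ∧
      ψ.Sat (Sum.elim (a.val p) ν) ∧ ψ'.Sat (Sum.elim (a.val q) fun x => ν x + δ)

/-- For every channel from `p` to `q`, the process `q` is never behind `p`. -/
def Ordered (x₀ : ∀ p, S.LClock p) (μ : S.LVal) : Prop :=
  ∀ p q, S.topology.Adj p q → μ p (x₀ p) ≤ μ q (x₀ q)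

/-- Configurations of the desynchronised semantics. -/
abbrev DeConfig (x₀ : ∀ p, S.LClock p) := {a : S.Config // S.Ordered x₀ a.val}

/-- Configurations of the rendezvous semantics: those of the desynchronised one in which all
channels are empty. -/
abbrev RvConfig (x₀ : ∀ p, S.LClock p) := {a : S.DeConfig x₀ // ∀ c, a.1.chan c = []}

/-- Actions of the desynchronised semantics: durations, and operations of the processes. -/
inductive DeAct
  | duration (δ : NNRat)
  | op (p : P) (o : S.Op p)

/-- Actions of the rendezvous semantics: additionally, pairs of operations. -/
inductive RvAct
  | duration (δ : NNRat)
  | op (p : P) (o : S.Op p)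
  | pair (p q : P) (o : S.Op p) (o' : S.Op q)

/-- Final valuations of the desynchronised semantics: every local clock is zero, except possibly the
special clocks, whose values are such that the final configuration is one of the desynchronised
semantics. -/
def FinalVal (x₀ : ∀ p, S.LClock p) :=
  {μ : S.LVal // (∀ p x, x ≠ x₀ p → μ p x = 0) ∧ S.Ordered x₀ μ}

/-- The transition relation of the desynchronised semantics. -/
def DeStep (x₀ : ∀ p, S.LClock p) (a : S.Config) : S.DeAct → S.Config → Prop
  | .duration δ, b => S.ElapseStep a δ b
  | .op p o, b => S.OpStep x₀ a p o b

/-- Sends and receives. -/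
def IsComm {S : TCA.{u, v} P} {p : P} : S.Op p → Prop
  | .send _ _ _ _ => True
  | .recv _ _ _ _ => True
  | _ => False

/-- The transition relation of the rendezvous semantics: the rules for send and receive are
replaced by the rendezvous. -/
def RvStep (x₀ : ∀ p, S.LClock p) (a : S.Config) : S.RvAct → S.Config → Prop
  | .duration δ, b => S.ElapseStep a δ b
  | .op p o, b => ¬ IsComm o ∧ S.OpStep x₀ a p o b
  | .pair p q o o', b => S.RendezvousStep x₀ a p q o o' b

/-- The desynchronised semantics, with final valuation `μ₁`. -/
def desync (x₀ : ∀ p, S.LClock p) (μ₁ : S.FinalVal x₀) : LTS (S.DeConfig x₀) S.DeAct where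
  init := ⟨S.initConfig, fun _ _ _ => le_rfl⟩
  final := ⟨S.finalConfig μ₁.1, μ₁.2.2⟩
  step := fun a α b => S.DeStep x₀ a.1 α b.1

/-- The rendezvous semantics, with final valuation `μ₁`. -/
def rendezvous (x₀ : ∀ p, S.LClock p) (μ₁ : S.FinalVal x₀) : LTS (S.RvConfig x₀) S.RvAct where
  init := ⟨(S.desync x₀ μ₁).init, fun _ => rfl⟩
  final := ⟨(S.desync x₀ μ₁).final, fun _ => rfl⟩
  step := fun a α b => S.RvStep x₀ a.1.1 α b.1.1

end TCA

/-! A rendezvous is a send followed at once by the matching receive, which gives one direction.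
Conversely, fix a desynchronised run and let each process replay its own actions in their original
order but at its own pace, pairing the n-th send on a channel with the n-th receive. A consistent
cut records how far each process has got. Guards read only the clocks of the executing process and
of the message, and between sending and receipt the message clocks grow by the receiver's special
clock at receipt minus the sender's at sending. Reordering affects none of these values
(`exists_sat_of_send_recv`).

It remains to exclude deadlock. An unfinished process is blocked only by an unfinished neighbour: a
partner that is not ready, or a receiver that an elapse would overtake. If nobody could move, each
of the finitely many unfinished processes would be mapped to an unfinished neighbour. In a forest
such a map swaps the ends of some edge (`exists_apply_apply_eq`), but two neighbours never wait for
each other, because they share a single channel and the original run already ordered their actions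
(`not_waits_symm`). -/

/-- A map that sends every vertex of a finite nonempty set in a forest to a neighbour in the same
set swaps the ends of some edge. -/
theorem SimpleGraph.IsAcyclic.exists_apply_apply_eq {V : Type*} {G : SimpleGraph V}
    (hG : G.IsAcyclic) {B : Set V} (hB : B.Finite) (hne : B.Nonempty) (f : V → V)
    (hf : ∀ v ∈ B, f v ∈ B) (hadj : ∀ v ∈ B, G.Adj v (f v)) : ∃ v ∈ B, f (f v) = v := by
  by_contra! hcon
  obtain ⟨p, hp⟩ := hne
  have key : ∀ n : ℕ, ∃ x ∈ B, ∃ (w : G.Walk (f x) p) (l : List (Sym2 V)),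
      w.IsPath ∧ w.length = n + 1 ∧ w.edges = s(f x, x) :: l ∧ ∀ v ∈ w.support, v ∈ B := by
    intro n
    induction n with
    | zero =>
      have h : G.Adj (f p) p := (hadj p hp).symm
      refine ⟨p, hp, .cons h .nil, [], ?_, rfl, rfl, ?_⟩
      · simpa using h.ne
      · simpa using ⟨hf p hp, hp⟩
    | succ n ih =>
      obtain ⟨x, hx, w, l, hw, hlen, hedges, hsupp⟩ := ih
      have h : G.Adj (f (f x)) (f x) := (hadj _ (hf x hx)).symm
      refine ⟨f x, hf x hx, .cons h w, w.edges, ?_, by simp [hlen], by simp, ?_⟩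
      -- In a forest a walk is a path as soon as it never backtracks. Prepending `f (f x)` would
      -- backtrack only if `f (f x) = x`.
      · rw [hG.isPath_iff_isChain] at hw ⊢
        rw [Walk.edges_cons, hedges, List.isChain_cons_cons, ← hedges]
        refine ⟨fun he => ?_, hw⟩
        rcases Sym2.eq_iff.1 he with ⟨h₁, -⟩ | ⟨h₁, -⟩
        · exact h.ne h₁
        · exact hcon x hx h₁
      · simpa using ⟨hf _ (hf x hx), hsupp⟩
  -- This path has two more vertices than `B` has elements.
  obtain ⟨x, -, w, l, hw, hlen, -, hsupp⟩ := key hB.toFinset.card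
  classical
  have h₁ : w.support.toFinset ⊆ hB.toFinset := fun v hv => by
    simpa using hsupp v (by simpa using hv)
  have h₂ := Finset.card_le_card h₁
  rw [List.toFinset_card_of_nodup hw.support_nodup, Walk.length_support] at h₂
  omega

namespace LTS

variable {C A : Type*} {L : LTS C A}

theorem Run.append {c d e : C} {w w' : List A} (h : L.Run c w d) (h' : L.Run d w' e) :
    L.Run c (w ++ w') e := by
  induction w generalizing c with
  | nil => obtain rfl : c = d := h; exact h'
  | cons a w ih =>
    obtain ⟨c', h₁, h₂⟩ := h
    exact ⟨c', h₁, ih h₂⟩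

/-- The sequences of configurations and actions of a run. -/
theorem Run.exists_seq [Nonempty A] {c d : C} {w : List A} (h : L.Run c w d) :
    ∃ (s : ℕ → C) (α : ℕ → A), s 0 = c ∧ s w.length = d ∧
      ∀ i < w.length, L.step (s i) (α i) (s (i + 1)) := by
  induction w generalizing c with
  | nil => exact ⟨fun _ => c, fun _ => Classical.arbitrary A, rfl, h, by simp⟩
  | cons a w ih =>
    obtain ⟨e, h₁, h₂⟩ := h
    obtain ⟨s, α, hs, hd, hstep⟩ := ih h₂
    refine ⟨fun i => Nat.casesOn i c s, fun i => Nat.casesOn i a α, rfl, hd, ?_⟩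
    rintro (_ | i) hi
    · simpa [hs] using h₁
    · exact hstep i (by simpa using hi)

end LTS

namespace TCASignature.Content

variable {P : Type u} {S : TCASignature.{u, v} P} {c : S.topology.Channel}

theorem shift_zero (u : S.Content c) : u.shift 0 = u := by
  simp [Content.shift]

end TCASignature.Content

theorem Digraph.IsPolyforest.ne {P : Type*} {T : Digraph P} (hT : T.IsPolyforest) (c : T.Channel) :
    c.src ≠ c.dst := fun h =>
  hT.asymm _ _ c.adj (by have := c.adj; rw [← h] at this ⊢; exact this)

theorem Digraph.Channel.eq_of_src_dst {P : Type*} {T : Digraph P} {c d : T.Channel}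
    (hs : c.src = d.src) (hd : c.dst = d.dst) : c = d := by
  cases c; cases d; cases hs; cases hd; rfl

/-! ### Effect of single actions on processes and channels -/

namespace TCA

variable {P : Type u} {S : TCA.{u, v} P} {x₀ : ∀ p, S.LClock p}

/-- The action is a send over the channel `c`. -/
def DeAct.SendsOn (c : S.topology.Channel) : S.DeAct → Prop
  | .op _ (.send _ d _ _) => d = c
  | _ => False

/-- The action is a receive from the channel `c`. -/
def DeAct.RecvsOn (c : S.topology.Channel) : S.DeAct → Prop
  | .op _ (.recv _ d _ _) => d = c
  | _ => False

theorem DeAct.SendsOn.exists_eq {α : S.DeAct} {c : S.topology.Channel} (h : α.SendsOn c) :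
    ∃ m ψ, α = .op c.src (.send m c rfl ψ) := by
  match α, h with
  | .op _ (.send m d hd ψ), h =>
    obtain rfl : d = c := h
    subst hd
    exact ⟨m, ψ, rfl⟩

theorem DeAct.RecvsOn.exists_eq {α : S.DeAct} {c : S.topology.Channel} (h : α.RecvsOn c) :
    ∃ m ψ, α = .op c.dst (.recv m c rfl ψ) := by
  match α, h with
  | .op _ (.recv m d hd ψ), h =>
    obtain rfl : d = c := h
    subst hd
    exact ⟨m, ψ, rfl⟩

/-- The action `α`, executed by the process `p`, leads from `a` to `b` in the desynchronised
semantics. -/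
def Moves (x₀ : ∀ p, S.LClock p) (a : S.Config) (p : P) : S.DeAct → S.Config → Prop
  | .duration δ, b => S.trans p (a.loc p) .elapse (b.loc p) ∧
      (∀ x, b.val p x = a.val p x + δ) ∧
      (∀ c, c.dst = p → b.chan c = (a.chan c).shift δ) ∧
      (∀ q, q ≠ p → b.loc q = a.loc q ∧ b.val q = a.val q) ∧
      ∀ c, c.dst ≠ p → b.chan c = a.chan c
  | .op q o, b => q = p ∧ S.OpStep x₀ a q o b

theorem DeStep.exists_moves {a b : S.Config} {α : S.DeAct} (h : S.DeStep x₀ a α b) :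
    ∃ p, S.Moves x₀ a p α b := by
  cases α with
  | duration δ => exact h
  | op p o => exact ⟨p, rfl, h⟩

namespace Moves

variable {a b : S.Config} {p : P} {α : S.DeAct}

theorem frame (h : S.Moves x₀ a p α b) {q : P} (hq : q ≠ p) :
    b.loc q = a.loc q ∧ b.val q = a.val q := by
  cases α with
  | duration δ => exact h.2.2.2.1 q hq
  | op r o =>
    obtain ⟨rfl, -, hloc, he⟩ := h
    refine ⟨hloc q hq, ?_⟩
    cases o with
    | nop => rw [he.1]
    | elapse => exact he.elim
    | test φ => rw [he.2.1]
    | reset x => exact he.1.2.2 q hq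
    | send m c hc ψ => rw [he.1]
    | recv m c hc ψ => rw [he.1]

/-- Only a reset could decrease a clock, and special clocks are never reset. -/
theorem clock_le (hx₀ : S.IsSpecial x₀) (h : S.Moves x₀ a p α b) (q : P) :
    a.val q (x₀ q) ≤ b.val q (x₀ q) := by
  by_cases hq : q = p
  · subst hq
    cases α with
    | duration δ => rw [h.2.1]; exact le_self_add
    | op r o =>
      obtain ⟨rfl, htr, hloc, he⟩ := h
      cases o with
      | nop => rw [he.1]
      | elapse => exact he.elim
      | test φ => rw [he.2.1]
      | reset x =>
        rw [he.1.2.1]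
        rintro rfl
        exact hx₀.not_reset _ _ _ htr
      | send m c hc ψ => rw [he.1]
      | recv m c hc ψ => rw [he.1]
  · rw [(h.frame hq).2]

theorem eq_src {c : S.topology.Channel} (h : S.Moves x₀ a p α b) (hs : α.SendsOn c) :
    p = c.src := by
  match α, h, hs with
  | .op _ (.send _ d hd _), h, hs =>
    exact h.1.symm.trans (hd.symm.trans (congrArg Digraph.Channel.src hs))

theorem eq_dst {c : S.topology.Channel} (h : S.Moves x₀ a p α b) (hs : α.RecvsOn c) :
    p = c.dst := by
  match α, h, hs with
  | .op _ (.recv _ d hd _), h, hs =>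
    exact h.1.symm.trans (hd.symm.trans (congrArg Digraph.Channel.dst hs))

/-- The effect of an action on a channel and on the special clock of its receiver. -/
theorem chan_cases (hx₀ : S.IsSpecial x₀) (h : S.Moves x₀ a p α b) (c : S.topology.Channel) :
    (α.SendsOn c ∧ ¬ α.RecvsOn c ∧ b.val = a.val ∧ ∃ e, b.chan c = e :: a.chan c) ∨
    (α.RecvsOn c ∧ ¬ α.SendsOn c ∧ b.val = a.val ∧ ∃ e, a.chan c = b.chan c ++ [e]) ∨
    (¬ α.SendsOn c ∧ ¬ α.RecvsOn c ∧ ∃ δ : NNRat, b.chan c = (a.chan c).shift δ ∧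
      b.val c.dst (x₀ c.dst) = a.val c.dst (x₀ c.dst) + δ) := by
  -- Actions that touch neither the channel nor the receiver's special clock count as a shift by
  -- zero, so they share a case with elapse.
  have same : b.chan c = a.chan c → b.val c.dst (x₀ c.dst) = a.val c.dst (x₀ c.dst) →
      ∃ δ : NNRat, b.chan c = (a.chan c).shift δ ∧
        b.val c.dst (x₀ c.dst) = a.val c.dst (x₀ c.dst) + δ := fun h₁ h₂ =>
    ⟨0, by rw [h₁, TCASignature.Content.shift_zero], by rw [h₂, add_zero]⟩
  cases α with
  | duration δ =>
    refine .inr (.inr ⟨id, id, ?_⟩)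
    by_cases hc : c.dst = p
    · subst hc
      exact ⟨δ, h.2.2.1 c rfl, h.2.1 _⟩
    · exact same (h.2.2.2.2 c hc) (by rw [(h.2.2.2.1 _ hc).2])
  | op r o =>
    have hfr := fun hq => (h.frame (q := c.dst) hq).2
    obtain ⟨rfl, htr, hloc, he⟩ := h
    cases o with
    | nop => exact .inr (.inr ⟨id, id, same (by rw [he.2]) (by rw [he.1])⟩)
    | elapse => exact he.elim
    | test φ => exact .inr (.inr ⟨id, id, same (by rw [he.2.2]) (by rw [he.2.1])⟩)
    | reset x =>
      refine .inr (.inr ⟨id, id, same (by rw [he.2]) ?_⟩)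
      by_cases hc : c.dst = r
      · subst hc
        refine he.1.2.1 _ ?_
        rintro rfl
        exact hx₀.not_reset _ _ _ htr
      · rw [hfr hc]
    | send m d hd ψ =>
      obtain ⟨hval, ⟨ν, δ, -, -, hch⟩, hfrc⟩ := he
      by_cases hcd : d = c
      · subst hcd
        exact .inl ⟨rfl, id, hval, _, hch⟩
      · exact .inr (.inr ⟨hcd, id, same (hfrc c (Ne.symm hcd)) (by rw [hval])⟩)
    | recv m d hd ψ =>
      obtain ⟨hval, ⟨ν, hch, -⟩, hfrc⟩ := he
      by_cases hcd : d = c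
      · subst hcd
        exact .inr (.inl ⟨rfl, id, hval, _, hch⟩)
      · exact .inr (.inr ⟨id, hcd, same (hfrc c (Ne.symm hcd)) (by rw [hval])⟩)

end Moves

/-! ### From rendezvous to desynchronised runs -/

/-- Every run of the rendezvous semantics is simulated by the desynchronised one: a rendezvous is a
send followed by the matching receive. -/
theorem nonEmpty_desync_of_rendezvous (hS : S.topology.IsPolyforest) {μ₁ : S.FinalVal x₀}
    (h : (S.rendezvous x₀ μ₁).NonEmpty) : (S.desync x₀ μ₁).NonEmpty := by
  classical
  obtain ⟨w, hw⟩ := h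
  suffices ∀ a b, (S.rendezvous x₀ μ₁).Run a w b → ∃ w', (S.desync x₀ μ₁).Run a.1 w' b.1 from
    this _ _ hw
  clear hw
  induction w with
  | nil => rintro a b rfl; exact ⟨[], rfl⟩
  | cons α w ih =>
    rintro a b ⟨e, hstep, hrun⟩
    obtain ⟨w', hw'⟩ := ih e b hrun
    suffices ∃ v, (S.desync x₀ μ₁).Run a.1 v e.1 from this.imp' (· ++ w') fun _ h => h.append hw'
    match α, hstep with
    | .duration δ, hstep => exact ⟨[.duration δ], e.1, hstep, rfl⟩
    | .op p o, hstep => exact ⟨[.op p o], e.1, hstep.2, rfl⟩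
    | .pair p q _ _, ⟨m, c, hp, hq, ψ, ψ', rfl, rfl, htp, htq, hloc, hval, ν, δ, hδ, hψ, hψ'⟩ =>
      subst hp hq
      have hne := hS.ne c
      -- The configuration between send and receive. The sender has moved and the message clocks are
      -- already advanced by `δ`; local clocks are untouched, so it is still ordered.
      let d : S.DeConfig x₀ :=
        ⟨⟨Function.update a.1.1.loc c.src (e.1.1.loc c.src), a.1.1.val,
          Function.update a.1.1.chan c [(m, fun x => ν x + δ)]⟩, a.1.2⟩
      refine ⟨[.op c.src (.send m c rfl ψ), .op c.dst (.recv m c rfl ψ')], d,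
        ⟨?_, ?_, rfl, ⟨ν, δ, hψ, hδ, ?_⟩, ?_⟩, e.1, ⟨?_, ?_, hval, ⟨_, ?_, hψ'⟩, ?_⟩, rfl⟩
      · simpa [d] using htp
      · intro r hr
        simp [d, hr]
      · simp [d, a.2 c]
      · intro c' hc'
        simp [d, hc']
      · simpa [d, hne.symm] using htq
      · intro r hr
        by_cases hr' : r = c.src
        · subst hr'; simp [d]
        · simpa [d, hr'] using hloc r hr' hr
      · simp [d, e.2 c]
      · intro c' hc'
        simp [d, hc', a.2 c', e.2 c']

/-! ### Counting sends and receives -/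

open scoped Classical in
/-- The number of sends over `c` among the first `i` actions. -/
noncomputable def sent (α : ℕ → S.DeAct) (c : S.topology.Channel) (i : ℕ) : ℕ :=
  Nat.count (fun k => (α k).SendsOn c) i

open scoped Classical in
/-- The number of receives from `c` among the first `i` actions. -/
noncomputable def received (α : ℕ → S.DeAct) (c : S.topology.Channel) (i : ℕ) : ℕ :=
  Nat.count (fun k => (α k).RecvsOn c) i

section Count

variable {α : ℕ → S.DeAct} {c : S.topology.Channel} {i j : ℕ}

theorem sent_zero : sent α c 0 = 0 := by simp [sent]

theorem received_zero : received α c 0 = 0 := by simp [received]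

theorem sent_mono (h : i ≤ j) : sent α c i ≤ sent α c j := by
  classical exact Nat.count_monotone _ h

theorem received_mono (h : i ≤ j) : received α c i ≤ received α c j := by
  classical exact Nat.count_monotone _ h

theorem sent_succ (h : (α i).SendsOn c) : sent α c (i + 1) = sent α c i + 1 := by
  simp [sent, Nat.count_succ, h]

theorem sent_succ_of_not (h : ¬ (α i).SendsOn c) : sent α c (i + 1) = sent α c i := by
  simp [sent, Nat.count_succ, h]

theorem received_succ (h : (α i).RecvsOn c) : received α c (i + 1) = received α c i + 1 := by
  simp [received, Nat.count_succ, h]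

theorem received_succ_of_not (h : ¬ (α i).RecvsOn c) : received α c (i + 1) = received α c i := by
  simp [received, Nat.count_succ, h]

end Count

/-! ### Histories and the FIFO discipline -/

/-- A run of the desynchronised semantics from and to empty channels: the configuration at each
time, and the action and the process that executes it. -/
structure History (S : TCA.{u, v} P) (x₀ : ∀ p, S.LClock p) where
  len : ℕ
  conf : ℕ → S.Config
  act : ℕ → S.DeAct
  proc : ℕ → P
  special : S.IsSpecial x₀
  ordered : ∀ i, S.Ordered x₀ (conf i).val
  moves : ∀ i < len, S.Moves x₀ (conf i) (proc i) (act i) (conf (i + 1))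
  chan_zero : ∀ c, (conf 0).chan c = []
  chan_len : ∀ c, (conf len).chan c = []

namespace History

variable (H : History S x₀)

/-- The value of the special clock of `p` at time `i`. -/
def now (p : P) (i : ℕ) : NNRat := (H.conf i).val p (x₀ p)

theorem now_mono (p : P) {i j : ℕ} (hij : i ≤ j) (hj : j ≤ H.len) : H.now p i ≤ H.now p j := by
  induction j, hij using Nat.le_induction with
  | base => exact le_rfl
  | succ j _ ih => exact (ih (by omega)).trans ((H.moves j hj).clock_le H.special p)

theorem received_add_length (c : S.topology.Channel) {i : ℕ} (hi : i ≤ H.len) :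
    received H.act c i + ((H.conf i).chan c).length = sent H.act c i := by
  induction i with
  | zero => simp [received_zero, sent_zero, H.chan_zero]
  | succ i ih =>
    have ih := ih (by omega)
    rcases (H.moves i hi).chan_cases H.special c with
      ⟨h₁, h₂, -, e, he⟩ | ⟨h₁, h₂, -, e, he⟩ | ⟨h₁, h₂, δ, he, -⟩
    · rw [sent_succ h₁, received_succ_of_not h₂, he, List.length_cons]; omega
    · rw [he, List.length_append, List.length_singleton] at ih
      rw [received_succ h₁, sent_succ_of_not h₂]; omega
    · rw [sent_succ_of_not h₁, received_succ_of_not h₂, he, TCASignature.Content.shift,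
        List.length_map, ih]

theorem received_le_sent (c : S.topology.Channel) {i : ℕ} (hi : i ≤ H.len) :
    received H.act c i ≤ sent H.act c i := by
  have := H.received_add_length c hi; omega

theorem received_len (c : S.topology.Channel) : received H.act c H.len = sent H.act c H.len := by
  simpa [H.chan_len] using H.received_add_length c le_rfl

/-- A message that was sent at time `i` stays in the channel at its position, and its clocks
advance with the special clock of the receiver, until it is received. -/
theorem exists_chan_eq {c : S.topology.Channel} {i : ℕ} {p : P} {m : S.Msg} {hc : c.src = p}
    {ψ : ClockConstraint (S.jointKind p c)} (hi : i < H.len)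
    (hact : H.act i = .op p (.send m c hc ψ)) :
    ∃ ν : S.CVal c, ψ.Sat (Sum.elim ((H.conf i).val p) ν) ∧
      ∀ t, i < t → t ≤ H.len → received H.act c t ≤ sent H.act c i →
        ∃ (A B : S.Content c) (γ : NNRat), B.length + received H.act c t = sent H.act c i ∧
          (H.conf t).chan c = A ++ (m, fun x => ν x + γ) :: B ∧
          H.now c.dst t = H.now c.src i + γ := by
  have hm := H.moves i hi
  have hs : (H.act i).SendsOn c := by rw [hact]; exact rfl
  have hlen := H.received_add_length c hi.le
  rcases hm.chan_cases H.special c with ⟨-, hnr, -⟩ | ⟨-, h, -⟩ | ⟨h, -⟩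
  rotate_left
  · exact absurd hs h
  · exact absurd hs h
  rw [hact] at hm
  obtain ⟨-, -, -, hval, ⟨ν, δ, hψ, hδ, hch⟩, -⟩ := hm
  refine ⟨ν, hψ, fun t hit => ?_⟩
  induction t, hit using Nat.le_induction with
  | base =>
    intro _ _
    -- `B` is the old channel content: exactly the messages to be received before this one.
    exact ⟨[], _, δ, by rw [received_succ_of_not hnr]; omega, hch, by simpa [now, hval] using hδ⟩
  | succ t hit ih =>
    intro ht hr
    obtain ⟨A, B, γ, hB, hA, hγ⟩ :=
      ih (by omega) ((received_mono (Nat.le_succ t)).trans hr)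
    rcases (H.moves t ht).chan_cases H.special c with
      ⟨h₁, h₂, hv, e, he⟩ | ⟨h₁, h₂, hv, e, he⟩ | ⟨h₁, h₂, δ', he, hv⟩
    · exact ⟨e :: A, B, γ, by rwa [received_succ_of_not h₂], by rw [he, hA, List.cons_append],
        by rw [← hγ]; simp [now, hv]⟩
    · rw [received_succ h₁] at hr ⊢
      -- A receive takes the last element of `B`. If `B` were empty, it would take the tracked
      -- message itself, against the bound `hr`.
      rcases B.eq_nil_or_concat with rfl | ⟨B', e', rfl⟩
      · simp only [List.length_nil] at hB; omega
      · refine ⟨A, B', γ, by simp at hB; omega, ?_, by rw [← hγ]; simp [now, hv]⟩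
        rw [hA] at he
        have he' : (A ++ (m, fun x => ν x + γ) :: B') ++ [e'] = (H.conf (t + 1)).chan c ++ [e] := by
          simpa using he
        exact (List.append_inj_left' he' rfl).symm
    · refine ⟨A.shift δ', B.shift δ', γ + δ', ?_, ?_, ?_⟩
      · rwa [received_succ_of_not h₂, TCASignature.Content.shift, List.length_map]
      · rw [he, hA]
        simp [TCASignature.Content.shift, add_assoc]
      · rw [← add_assoc, ← hγ]; exact hv

/-- The `n`-th send over a channel and the `n`-th receive from it can be executed as a
rendezvous. -/
theorem exists_sat_of_send_recv {c : S.topology.Channel} {i j : ℕ} {p q : P} {m m' : S.Msg}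
    {hp : c.src = p} {hq : c.dst = q} {ψ : ClockConstraint (S.jointKind p c)}
    {ψ' : ClockConstraint (S.jointKind q c)} (hi : i < H.len) (hj : j < H.len)
    (hsend : H.act i = .op p (.send m c hp ψ)) (hrecv : H.act j = .op q (.recv m' c hq ψ'))
    (heq : sent H.act c i = received H.act c j) :
    m' = m ∧ ∃ (ν : S.CVal c) (γ : NNRat), H.now q j = H.now p i + γ ∧
      ψ.Sat (Sum.elim ((H.conf i).val p) ν) ∧
      ψ'.Sat (Sum.elim ((H.conf j).val q) fun x => ν x + γ) := by
  subst hp hq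
  obtain ⟨ν, hν, htrack⟩ := H.exists_chan_eq hi hsend
  have hm := H.moves j hj
  rw [hrecv] at hm
  obtain ⟨-, -, -, -, ⟨ν', hch, hψ'⟩, -⟩ := hm
  have hlen := H.received_add_length c hj.le
  -- Otherwise at most `sent H.act c i` messages are sent by time `j`; all of these are already
  -- received, yet the channel is nonempty.
  have hij : i < j := by
    by_contra! hji
    have := sent_mono (α := H.act) (c := c) hji
    rw [hch, List.length_append, List.length_singleton] at hlen
    omega
  obtain ⟨A, B, γ, hB, hA, hγ⟩ := htrack j hij hj.le heq.ge
  obtain rfl : B = [] := List.length_eq_zero_iff.1 (by omega)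
  rw [hch] at hA
  obtain ⟨rfl, rfl⟩ := Prod.mk.inj (List.singleton_inj.1 (List.append_inj_right' hA rfl))
  exact ⟨rfl, ν, γ, hγ, hν, hψ'⟩

/-! ### Cuts of a history -/

/-- A cut `κ`, where `κ p` is the time up to which `p` has been executed, is consistent if it has
no pending messages and no process is ahead of a receiver of its messages. -/
structure Consistent (κ : P → ℕ) : Prop where
  le_len : ∀ p, κ p ≤ H.len
  sent_eq : ∀ c : S.topology.Channel, sent H.act c (κ c.src) = received H.act c (κ c.dst)
  now_le : ∀ p q, S.topology.Adj p q → H.now p (κ p) ≤ H.now q (κ q)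

/-- The configuration at a consistent cut. -/
def cutConfig (κ : P → ℕ) (hκ : H.Consistent κ) : S.RvConfig x₀ :=
  ⟨⟨⟨fun p => (H.conf (κ p)).loc p, fun p => (H.conf (κ p)).val p, fun _ => []⟩, hκ.now_le⟩,
    fun _ => rfl⟩

/-- Nothing that concerns the process `p` happens between `i` and `j`. -/
structure Idle (p : P) (i j : ℕ) : Prop where
  loc : (H.conf j).loc p = (H.conf i).loc p
  val : (H.conf j).val p = (H.conf i).val p
  sent : ∀ c : S.topology.Channel, c.src = p → sent H.act c j = sent H.act c i
  received : ∀ c : S.topology.Channel, c.dst = p → received H.act c j = received H.act c i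

/-- Actions of other processes leave everything recorded by `Idle` unchanged, so one may skip to the
next action of `p`, or to the end. -/
theorem exists_next (p : P) {i : ℕ} (hi : i ≤ H.len) :
    ∃ j, i ≤ j ∧ j ≤ H.len ∧ (j < H.len → H.proc j = p) ∧ H.Idle p i j := by
  induction hi using Nat.decreasingInduction with
  | self => exact ⟨H.len, le_rfl, le_rfl, fun h => absurd h (lt_irrefl _), rfl, rfl,
      fun _ _ => rfl, fun _ _ => rfl⟩
  | of_succ i hi ih =>
    by_cases hp : H.proc i = p
    · exact ⟨i, le_rfl, hi.le, fun _ => hp, rfl, rfl, fun _ _ => rfl, fun _ _ => rfl⟩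
    · obtain ⟨j, h₁, h₂, h₃, h₄⟩ := ih
      have hm := H.moves i hi
      have hfr := hm.frame (Ne.symm hp)
      refine ⟨j, by omega, h₂, h₃, h₄.loc.trans hfr.1, h₄.val.trans hfr.2, fun c hc => ?_,
        fun c hc => ?_⟩
      · rw [h₄.sent c hc, sent_succ_of_not fun hs => hp ((hm.eq_src hs).trans hc)]
      · rw [h₄.received c hc, received_succ_of_not fun hs => hp ((hm.eq_dst hs).trans hc)]

/-- Every process that is not finished at the cut `κ` executes the next action. -/
def Tight (κ : P → ℕ) : Prop := ∀ p, κ p < H.len → H.proc (κ p) = p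

/-- Skipping idle times does not change the configuration at the cut, so it costs no step. -/
theorem Consistent.exists_tight {κ : P → ℕ} (hκ : H.Consistent κ) :
    ∃ κ' : P → ℕ, ∃ hκ' : H.Consistent κ', H.Tight κ' ∧ κ ≤ κ' ∧
      H.cutConfig κ' hκ' = H.cutConfig κ hκ := by
  choose κ' h₁ h₂ h₃ h₄ using fun p => H.exists_next p (hκ.le_len p)
  refine ⟨κ', ⟨h₂, fun c => ?_, fun p q hpq => ?_⟩, h₃, h₁, ?_⟩
  · rw [(h₄ _).sent c rfl, (h₄ _).received c rfl, hκ.sent_eq]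
  · simpa [now, (h₄ _).val] using hκ.now_le p q hpq
  · simp [cutConfig, (h₄ _).val, (h₄ _).loc]

/-! ### Progress and absence of deadlock -/

/-- The unfinished process `p` has to wait for `q` at the cut `κ`. -/
def Waits (κ : P → ℕ) (p q : P) : Prop :=
  κ q < H.len ∧ ∃ c : S.topology.Channel,
    -- The case of a blocked elapse. Only the order of the two times is kept, which is all that the
    -- deadlock argument needs.
    (c.src = p ∧ c.dst = q ∧ κ q ≤ κ p) ∨
    (c.src = p ∧ c.dst = q ∧ (H.act (κ p)).SendsOn c ∧ ¬ (H.act (κ q)).RecvsOn c) ∨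
    (c.dst = p ∧ c.src = q ∧ (H.act (κ p)).RecvsOn c ∧ ¬ (H.act (κ q)).SendsOn c)

/-- The cut `κ` can be advanced by a step of the rendezvous semantics. -/
def Advances (κ : P → ℕ) (hκ : H.Consistent κ) : Prop :=
  ∃ (κ' : P → ℕ) (hκ' : H.Consistent κ') (α : S.RvAct),
    κ ≤ κ' ∧ (∃ p, κ p < H.len ∧ κ p < κ' p) ∧
      S.RvStep x₀ (H.cutConfig κ hκ).1.1 α (H.cutConfig κ' hκ').1.1

variable {H} {κ : P → ℕ}

-- The clock of `p` only grows, so the order can fail only on channels leaving `p`.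
open scoped Classical in
theorem Consistent.update (hκ : H.Consistent κ) {p : P} (hp : κ p < H.len)
    (hs : ∀ c, ¬ (H.act (κ p)).SendsOn c) (hr : ∀ c, ¬ (H.act (κ p)).RecvsOn c)
    (hnow : ∀ q, S.topology.Adj p q → H.now p (κ p + 1) ≤ H.now q (κ q)) :
    H.Consistent (Function.update κ p (κ p + 1)) where
  le_len q := by
    by_cases hq : q = p
    · subst hq; simpa using hp
    · simpa [hq] using hκ.le_len q
  sent_eq c := by
    have h₁ : sent H.act c (Function.update κ p (κ p + 1) c.src) = sent H.act c (κ c.src) := by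
      by_cases hq : c.src = p
      · rw [hq, Function.update_self, sent_succ_of_not (hs c)]
      · rw [Function.update_of_ne hq]
    have h₂ : received H.act c (Function.update κ p (κ p + 1) c.dst) =
        received H.act c (κ c.dst) := by
      by_cases hq : c.dst = p
      · rw [hq, Function.update_self, received_succ_of_not (hr c)]
      · rw [Function.update_of_ne hq]
    rw [h₁, h₂, hκ.sent_eq]
  now_le q r hqr := by
    by_cases hr : r = p
    · subst hr
      by_cases hq : q = r
      · subst hq; exact le_rfl
      · simpa [hq] using (hκ.now_le _ _ hqr).trans (H.now_mono r (Nat.le_succ _) hp)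
    · by_cases hq : q = p
      · subst hq; simpa [hr] using hnow r hqr
      · simpa [hr, hq] using hκ.now_le q r hqr

theorem Consistent.advances_of_duration (hκ : H.Consistent κ) {p : P} {δ : NNRat}
    (hp : κ p < H.len) (hproc : H.proc (κ p) = p) (hact : H.act (κ p) = .duration δ)
    (hnow : ∀ q, S.topology.Adj p q → H.now p (κ p + 1) ≤ H.now q (κ q)) :
    H.Advances κ hκ := by
  classical
  have hm := H.moves _ hp
  rw [hact, hproc] at hm
  obtain ⟨htr, hval, -⟩ := hm
  have hs : ∀ c, ¬ (H.act (κ p)).SendsOn c := fun c => by rw [hact]; exact id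
  have hr : ∀ c, ¬ (H.act (κ p)).RecvsOn c := fun c => by rw [hact]; exact id
  refine ⟨_, hκ.update hp hs hr hnow, .duration δ, by simp,
    ⟨p, hp, by simp⟩, p, ?_, ?_, fun _ _ => rfl, ?_, fun _ _ => rfl⟩
  · simpa [cutConfig] using htr
  · simpa [cutConfig] using hval
  · intro q hq
    simp [cutConfig, hq]

theorem Consistent.advances_of_op (hκ : H.Consistent κ) {p : P} {o : S.Op p}
    (hp : κ p < H.len) (hact : H.act (κ p) = .op p o) (ho : ¬ IsComm o) :
    H.Advances κ hκ := by
  classical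
  have hm := H.moves _ hp
  rw [hact] at hm
  obtain ⟨-, htr, -, he⟩ := hm
  have hs : ∀ c, ¬ (H.act (κ p)).SendsOn c := fun c => by
    rw [hact]; cases o <;> first | exact id | exact absurd trivial ho
  have hr : ∀ c, ¬ (H.act (κ p)).RecvsOn c := fun c => by
    rw [hact]; cases o <;> first | exact id | exact absurd trivial ho
  have hx : H.now p (κ p + 1) = H.now p (κ p) := by
    cases o with
    | nop => simp [now, he.1]
    | elapse => exact he.elim
    | test φ => simp [now, he.2.1]
    | reset x =>
      refine he.1.2.1 _ ?_
      rintro rfl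
      exact H.special.not_reset _ _ _ htr
    | send | recv => exact absurd trivial ho
  refine ⟨_, hκ.update hp hs hr fun q hq => hx.trans_le (hκ.now_le p q hq), .op p o,
    by simp, ⟨p, hp, by simp⟩, ho, ?_, ?_, ?_⟩
  · simpa [cutConfig] using htr
  · intro q hq
    simp [cutConfig, hq]
  · have same : (H.conf (κ p + 1)).val = (H.conf (κ p)).val →
        (fun q => (H.conf (Function.update κ p (κ p + 1) q)).val q) =
          fun q => (H.conf (κ q)).val q := fun h => by
      funext q
      by_cases hq : q = p
      · subst hq; simp [h]
      · simp [hq]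
    cases o with
    | nop => exact ⟨same he.1, rfl⟩
    | elapse => exact he.elim
    | test φ => exact ⟨he.1, same he.2.1, rfl⟩
    | reset x =>
      refine ⟨⟨?_, ?_, ?_⟩, rfl⟩
      · simpa [cutConfig] using he.1.1
      · simpa [cutConfig] using he.1.2.1
      · intro q hq
        simp [cutConfig, hq]
    | send | recv => exact absurd trivial ho

/-- At a consistent cut the counts on `c` agree, so the pending send and receive concern the same
message of the history. Neither changes a local clock, so the order persists. -/
theorem Consistent.advances_of_pair (hS : S.topology.IsPolyforest) (hκ : H.Consistent κ)
    {c : S.topology.Channel} (hs : κ c.src < H.len) (hd : κ c.dst < H.len)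
    (hsp : H.proc (κ c.src) = c.src) (hdp : H.proc (κ c.dst) = c.dst)
    (hsend : (H.act (κ c.src)).SendsOn c) (hrecv : (H.act (κ c.dst)).RecvsOn c) :
    H.Advances κ hκ := by
  classical
  have hne := hS.ne c
  have hms := H.moves _ hs
  have hmd := H.moves _ hd
  obtain ⟨m, ψ, hsend'⟩ : ∃ m ψ, H.act (κ c.src) = .op c.src (.send m c rfl ψ) :=
    hsend.exists_eq
  obtain ⟨m', ψ', hrecv'⟩ : ∃ m ψ, H.act (κ c.dst) = .op c.dst (.recv m c rfl ψ) :=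
    hrecv.exists_eq
  obtain ⟨rfl, ν, γ, hγ, hψ, hψ'⟩ :=
    H.exists_sat_of_send_recv hs hd hsend' hrecv' (hκ.sent_eq c)
  have hsv : (H.conf (κ c.src + 1)).val = (H.conf (κ c.src)).val := by
    rw [hsend'] at hms; exact hms.2.2.2.1
  have hdv : (H.conf (κ c.dst + 1)).val = (H.conf (κ c.dst)).val := by
    rw [hrecv'] at hmd; exact hmd.2.2.2.1
  let κ' : P → ℕ := fun r => if r = c.src ∨ r = c.dst then κ r + 1 else κ r
  have hval : ∀ r, (H.conf (κ' r)).val r = (H.conf (κ r)).val r := fun r => by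
    by_cases h₁ : r = c.src
    · subst h₁; simp [κ', hsv]
    · by_cases h₂ : r = c.dst
      · subst h₂; simp [κ', hdv]
      · simp [κ', h₁, h₂]
  have hκ' : H.Consistent κ' := by
    refine ⟨fun r => ?_, fun d => ?_, fun p q hpq => ?_⟩
    · by_cases h₁ : r = c.src
      · subst h₁; simpa [κ'] using hs
      · by_cases h₂ : r = c.dst
        · subst h₂; simpa [κ'] using hd
        · simpa [κ', h₁, h₂] using hκ.le_len r
    · have notSends : ∀ {α : S.DeAct}, α.RecvsOn c → ¬ α.SendsOn d := fun {α} h => by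
        match α, h with
        | .op _ (.recv _ _ _ _), _ => exact id
      have notRecvs : ∀ {α : S.DeAct}, α.SendsOn c → ¬ α.RecvsOn d := fun {α} h => by
        match α, h with
        | .op _ (.send _ _ _ _), _ => exact id
      have h₁ : sent H.act d (κ' d.src) = sent H.act d (κ d.src) + if d = c then 1 else 0 := by
        by_cases hdc : d = c
        · subst hdc; simp [κ', sent_succ hsend]
        · by_cases h₁ : d.src = c.src
          · have : ¬ (H.act (κ c.src)).SendsOn d := by
              rw [hsend']; exact fun h => hdc h.symm
            simp [κ', h₁, hdc, sent_succ_of_not this]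
          · by_cases h₂ : d.src = c.dst
            · simp [κ', h₂, hdc, sent_succ_of_not (notSends hrecv)]
            · simp [κ', h₁, h₂, hdc]
      have h₂ : received H.act d (κ' d.dst) =
          received H.act d (κ d.dst) + if d = c then 1 else 0 := by
        by_cases hdc : d = c
        · subst hdc; simp [κ', received_succ hrecv]
        · by_cases h₁ : d.dst = c.dst
          · have : ¬ (H.act (κ c.dst)).RecvsOn d := by
              rw [hrecv']; exact fun h => hdc h.symm
            simp [κ', h₁, hdc, received_succ_of_not this]
          · by_cases h₂ : d.dst = c.src
            · simp [κ', h₂, hdc, received_succ_of_not (notRecvs hsend)]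
            · simp [κ', h₁, h₂, hdc]
      rw [h₁, h₂, hκ.sent_eq]
    · simpa [now, hval] using hκ.now_le p q hpq
  refine ⟨κ', hκ', .pair c.src c.dst (.send m' c rfl ψ) (.recv m' c rfl ψ'), fun r => ?_,
    ⟨c.src, hs, by simp [κ']⟩, m', c, rfl, rfl, ψ, ψ', rfl, rfl, ?_, ?_, ?_, funext hval,
    ν, γ, hγ, hψ, hψ'⟩
  · simp only [κ']; split_ifs <;> omega
  · rw [hsend'] at hms
    simpa [cutConfig, κ'] using hms.2.1
  · rw [hrecv'] at hmd
    simpa [cutConfig, κ'] using hmd.2.1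
  · intro r h₁ h₂
    simp [cutConfig, κ', h₁, h₂]

/-- An unfinished process can execute its next action or has to wait for a neighbour. -/
theorem Consistent.advances_or_waits (hS : S.topology.IsPolyforest) (hκ : H.Consistent κ)
    (ht : H.Tight κ) {p : P} (hp : κ p < H.len) :
    H.Advances κ hκ ∨ ∃ q, H.Waits κ p q := by
  have hm := H.moves _ hp
  rw [ht p hp] at hm
  have send : ∀ c, (H.act (κ p)).SendsOn c → H.Advances κ hκ ∨ ∃ q, H.Waits κ p q := by
    intro c hsend
    obtain rfl := hm.eq_src hsend
    -- A finished receiver has received every message ever sent on `c`, so consistency would leave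
    -- no send pending.
    have hd : κ c.dst < H.len := by
      refine lt_of_le_of_ne (hκ.le_len _) fun h => ?_
      have h₁ := hκ.sent_eq c
      have h₂ := sent_mono (α := H.act) (c := c) hp
      rw [h, H.received_len] at h₁
      rw [sent_succ hsend] at h₂
      omega
    by_cases hrecv : (H.act (κ c.dst)).RecvsOn c
    · exact .inl (hκ.advances_of_pair hS hp hd (ht _ hp) (ht _ hd) hsend hrecv)
    · exact .inr ⟨_, hd, c, .inr (.inl ⟨rfl, rfl, hsend, hrecv⟩)⟩
  have recv : ∀ c, (H.act (κ p)).RecvsOn c → H.Advances κ hκ ∨ ∃ q, H.Waits κ p q := by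
    intro c hrecv
    obtain rfl := hm.eq_dst hrecv
    have hs : κ c.src < H.len := by
      refine lt_of_le_of_ne (hκ.le_len _) fun h => ?_
      have h₁ := hκ.sent_eq c
      have h₂ := received_mono (α := H.act) (c := c) hp
      rw [h, ← H.received_len] at h₁
      rw [received_succ hrecv] at h₂
      omega
    by_cases hsend : (H.act (κ c.src)).SendsOn c
    · exact .inl (hκ.advances_of_pair hS hs hp (ht _ hs) (ht _ hp) hsend hrecv)
    · exact .inr ⟨_, hs, c, .inr (.inr ⟨rfl, rfl, hrecv, hsend⟩)⟩
  cases hact : H.act (κ p) with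
  | duration δ =>
    by_cases hnow : ∀ q, S.topology.Adj p q → H.now p (κ p + 1) ≤ H.now q (κ q)
    · exact .inl (hκ.advances_of_duration hp (ht p hp) hact hnow)
    · push Not at hnow
      obtain ⟨q, hpq, hlt⟩ := hnow
      -- If `q` were further on, the order at time `κ p + 1` of the original run and the
      -- monotonicity of the clock of `q` would permit the elapse.
      have hle : κ q ≤ κ p := by
        by_contra! h
        have h₁ : H.now p (κ p + 1) ≤ H.now q (κ p + 1) := H.ordered _ p q hpq
        exact absurd hlt (not_lt.2 (h₁.trans (H.now_mono q h (hκ.le_len q))))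
      exact .inr ⟨q, hle.trans_lt hp, ⟨p, q, hpq⟩, .inl ⟨rfl, rfl, hle⟩⟩
  | op r o =>
    have hr : r = p := by rw [hact] at hm; exact hm.1
    subst hr
    cases o with
    | send m c hc ψ => exact send c (by rw [hact]; exact rfl)
    | recv m c hc ψ => exact recv c (by rw [hact]; exact rfl)
    | _ => exact .inl (hκ.advances_of_op hp hact id)

/-- Two processes do not wait for each other. -/
theorem Consistent.not_waits_symm (hS : S.topology.IsPolyforest) (hκ : H.Consistent κ)
    (ht : H.Tight κ) {p q : P} (hpq : H.Waits κ p q) (hqp : H.Waits κ q p) : False := by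
  have opposite : ∀ c d : S.topology.Channel, c.src = d.dst → c.dst = d.src → False :=
    fun c d h₁ h₂ => hS.asymm _ _ c.adj (by rw [h₁, h₂]; exact d.adj)
  -- The times differ because the two actions have different executors. So the pending receive
  -- precedes time `κ c.src`, by which its message must have been sent; but consistency says that
  -- only the earlier messages were.
  have mixed : ∀ c : S.topology.Channel, κ c.src < H.len → κ c.dst < H.len →
      κ c.dst ≤ κ c.src → (H.act (κ c.dst)).RecvsOn c → False := by
    intro c hs hd hle hr
    have hne : κ c.dst ≠ κ c.src := fun h =>
      hS.ne c (by rw [← ht _ hs, ← ht _ hd, h])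
    have h₁ := received_mono (α := H.act) (c := c) (lt_of_le_of_ne hle hne)
    rw [received_succ hr] at h₁
    have h₂ := H.received_le_sent c hs.le
    have h₃ := hκ.sent_eq c
    omega
  obtain ⟨hq, c, hc⟩ := hpq
  obtain ⟨hp, d, hd⟩ := hqp
  rcases hc with ⟨rfl, rfl, hc⟩ | ⟨rfl, rfl, hc⟩ | ⟨rfl, rfl, hc⟩ <;>
    rcases hd with ⟨h₁, h₂, hd⟩ | ⟨h₁, h₂, hd⟩ | ⟨h₁, h₂, hd⟩
  · exact opposite _ _ h₂.symm h₁.symm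
  · exact opposite _ _ h₂.symm h₁.symm
  · obtain rfl := Digraph.Channel.eq_of_src_dst h₂ h₁
    exact mixed _ hp hq hc hd.1
  · exact opposite _ _ h₂.symm h₁.symm
  · exact opposite _ _ h₂.symm h₁.symm
  · obtain rfl := Digraph.Channel.eq_of_src_dst h₂ h₁
    exact hc.2 hd.1
  · obtain rfl := Digraph.Channel.eq_of_src_dst h₁ h₂
    exact mixed _ hq hp hd hc.1
  · obtain rfl := Digraph.Channel.eq_of_src_dst h₁ h₂
    exact hc.2 hd.1
  · exact opposite _ _ h₁.symm h₂.symm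

theorem Waits.adj {p q : P} (hS : S.topology.IsPolyforest) (h : H.Waits κ p q) :
    S.topology.toSimpleGraphInclusive.Adj p q := by
  rw [Digraph.toSimpleGraphInclusive, SimpleGraph.fromRel_adj]
  obtain ⟨-, c, ⟨rfl, rfl, -⟩ | ⟨rfl, rfl, -⟩ | ⟨rfl, rfl, -⟩⟩ := h
  · exact ⟨hS.ne c, .inl c.adj⟩
  · exact ⟨hS.ne c, .inl c.adj⟩
  · exact ⟨(hS.ne c).symm, .inr c.adj⟩

/-- There is no deadlock before the end of the history. -/
theorem Consistent.advances (hS : S.topology.IsPolyforest) (hκ : H.Consistent κ)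
    (ht : H.Tight κ) {p : P} (hp : κ p < H.len) : H.Advances κ hκ := by
  by_contra hcon
  have hw : ∀ q, ∃ r, κ q < H.len → H.Waits κ q r := fun q => by
    by_cases hq : κ q < H.len
    · obtain ⟨r, hr⟩ := (hκ.advances_or_waits hS ht hq).resolve_left hcon
      exact ⟨r, fun _ => hr⟩
    · exact ⟨q, fun h => absurd h hq⟩
  choose f hf using hw
  -- There may be infinitely many processes, but by tightness each unfinished one executes some
  -- action of the finite history.
  have hfin : {q | κ q < H.len}.Finite :=
    ((Finset.range H.len).finite_toSet.image H.proc).subset fun q hq =>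
      ⟨κ q, by simpa using hq, ht q hq⟩
  obtain ⟨q, hq, hqq⟩ := hS.forest.exists_apply_apply_eq hfin ⟨p, hp⟩ f
    (fun q hq => (hf q hq).1) fun q hq => (hf q hq).adj hS
  have h₁ := hf q hq
  have h₂ := hf _ h₁.1
  rw [hqq] at h₂
  exact hκ.not_waits_symm hS ht h₁ h₂

/-- From every consistent cut the rendezvous semantics reaches the end of the history. -/
theorem Consistent.exists_run (hS : S.topology.IsPolyforest) {μ₁ : S.FinalVal x₀}
    (hend : H.conf H.len = S.finalConfig μ₁.1) (hκ : H.Consistent κ) :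
    ∃ w, (S.rendezvous x₀ μ₁).Run (H.cutConfig κ hκ) w (S.rendezvous x₀ μ₁).final := by
  classical
  -- The measure is the number of actions not yet replayed. A step from the tight cut `κ₁` removes
  -- at least the action at `κ₁ q`.
  induction hn : ((Finset.range H.len).filter fun i => κ (H.proc i) ≤ i).card
    using Nat.strong_induction_on generalizing κ with
  | _ n ih =>
    obtain ⟨κ₁, hκ₁, ht, hle, heq⟩ := hκ.exists_tight
    rw [← heq]
    by_cases hfin : ∃ p, κ₁ p < H.len
    · obtain ⟨p, hp⟩ := hfin
      obtain ⟨κ₂, hκ₂, α, hle₂, ⟨q, hq, hq₂⟩, hstep⟩ := hκ₁.advances hS ht hp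
      obtain ⟨w, hw⟩ := ih _ (by
        rw [← hn]
        refine Finset.card_lt_card (Finset.ssubset_iff_of_subset ?_ |>.2 ⟨κ₁ q, ?_, ?_⟩)
        · intro i hi
          rw [Finset.mem_filter] at hi ⊢
          exact ⟨hi.1, (hle _).trans ((hle₂ _).trans hi.2)⟩
        · rw [Finset.mem_filter, ht q hq, Finset.mem_range]
          exact ⟨hq, hle q⟩
        · rw [Finset.mem_filter, ht q hq]
          omega) hκ₂ rfl
      exact ⟨α :: w, _, hstep, hw⟩
    · push Not at hfin
      obtain rfl : κ₁ = fun _ => H.len := funext fun p => le_antisymm (hκ₁.le_len p) (hfin p)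
      refine ⟨[], Subtype.ext (Subtype.ext ?_)⟩
      simp [cutConfig, hend, rendezvous, desync, finalConfig]

end History

/-- Every run of the desynchronised semantics over a polyforest can be reordered into a run of the
rendezvous semantics. -/
theorem nonEmpty_rendezvous_of_desync (hx₀ : S.IsSpecial x₀) (hS : S.topology.IsPolyforest)
    {μ₁ : S.FinalVal x₀} (h : (S.desync x₀ μ₁).NonEmpty) : (S.rendezvous x₀ μ₁).NonEmpty := by
  obtain ⟨w, hw⟩ := h
  have : Nonempty S.DeAct := ⟨.duration 0⟩
  obtain ⟨s, α, h₀, h₁, hstep⟩ := hw.exists_seq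
  -- A nonempty run supplies a process, used below as the default executor after the end; without
  -- actions there might be none.
  by_cases hlen : w.length = 0
  · obtain rfl := List.length_eq_zero_iff.1 hlen
    exact ⟨[], Subtype.ext hw⟩
  have : Nonempty P := ⟨(hstep 0 (by omega)).exists_moves.choose⟩
  have hproc : ∀ i, ∃ p, i < w.length → S.Moves x₀ (s i).1 p (α i) (s (i + 1)).1 := fun i => by
    by_cases hi : i < w.length
    · exact (hstep i hi).exists_moves.imp fun _ h _ => h
    · exact ⟨Classical.arbitrary P, fun h => absurd h hi⟩
  choose proc hproc using hproc
  let H : History S x₀ :=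
    { len := w.length
      conf := fun i => (s i).1
      act := α
      proc := proc
      special := hx₀
      ordered := fun i => (s i).2
      moves := hproc
      chan_zero := fun c => by rw [h₀]; rfl
      chan_len := fun c => by rw [h₁]; rfl }
  have hκ : H.Consistent fun _ => 0 :=
    ⟨fun _ => Nat.zero_le _, fun c => by rw [sent_zero, received_zero], H.ordered 0⟩
  obtain ⟨w', hw'⟩ := hκ.exists_run hS (μ₁ := μ₁) (by simp [H, h₁, desync])
  refine ⟨w', ?_⟩
  have hinit : H.cutConfig (fun _ => 0) hκ = (S.rendezvous x₀ μ₁).init := by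
    refine Subtype.ext (Subtype.ext ?_)
    simp [History.cutConfig, H, h₀, rendezvous, desync, initConfig]
  rwa [hinit] at hw'

end TCA

theorem mainTheorem6 {P : Type*} (S : TCA P) (x₀ : ∀ p, S.LClock p) (hx₀ : S.IsSpecial x₀)
    (hS : S.topology.IsPolyforest) :
    (∀ μ₁ : S.FinalVal x₀, (S.desync x₀ μ₁).Equivalent (S.rendezvous x₀ μ₁)) ∧
      ((∃ μ₁ : S.FinalVal x₀, (S.desync x₀ μ₁).NonEmpty) ↔
        ∃ μ₁ : S.FinalVal x₀, (S.rendezvous x₀ μ₁).NonEmpty) := by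
  have h : ∀ μ₁ : S.FinalVal x₀, (S.desync x₀ μ₁).Equivalent (S.rendezvous x₀ μ₁) := fun _ =>
    ⟨TCA.nonEmpty_rendezvous_of_desync hx₀ hS, TCA.nonEmpty_desync_of_rendezvous hS⟩
  exact ⟨h, exists_congr h⟩
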